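/- Let $A\in\mathbb{C}^{n\times n}$, $B\in\mathbb{C}^{n\times m}$, let $R\in\mathbb{C}^{m\times m}$ be Hermitian and nonsingular and $H\in\mathbb{C}^{n\times n}$ Hermitian. Write $\overline{M}$ for the entrywise conjugate, $M^H$ for the conjugate transpose, $\rho$ for the spectral radius, and $M\ge N$ if $M-N$ is positive semidefinite. For Hermitian $X$ put $R_X=R+B^H\overline{X}B$ and let $\mathrm{dom}(\mathcal{R})$ be the set of Hermitian $X$ with $\det R_X\neq 0$. For $X\in\mathrm{dom}(\mathcal{R})$ let $$\mathcal{R}(X)=A^H\overline{X}A-A^H\overline{X}B\,R_X^{-1}B^H\overline{X}A+H,\qquad F_X=R_X^{-1}B^H\overline{X}A,\qquad T_X=A-BF_X,$$ and set $\mathbb{T}=\{X\in\mathrm{dom}(\mathcal{R}):\rho(\overline{T_X}T_X)<1\}$, $\mathbb{P}=\{X\in\mathrm{dom}(\mathcal{R}):R_X>0\}$, $\mathcal{R}_\le=\{X\in\mathrm{dom}(\mathcal{R}):X\le\mathcal{R}(X)\}$. Assume that $$\mathbb{T}\neq\emptyset,\qquad \mathcal{R}_\le\cap\mathbb{P}\neq\emptyset,\qquad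 \det R_H\neq 0 .$$ Let $G=BR^{-1}B^H$ and $$\widehat{A}=\overline{A}A-\overline{A}BR_H^{-1}B^H\overline{H}A,\quad \widehat{B}=[\,\overline{B}\;\;\overline{A}B\,],\quad \widehat{R}=\overline{R}\oplus R_H,\quad \widehat{H}=H+A^H\overline{H}(I+G\overline{H})^{-1}A,$$ $$\widehat{R}_X=\widehat{R}+\widehat{B}^HX\widehat{B},\qquad \widehat{\mathcal{R}}(X)=\widehat{A}^HX\widehat{A}-\widehat{A}^HX\widehat{B}\,\widehat{R}_X^{-1}\widehat{B}^HX\widehat{A}+\widehat{H}\quad(\det\widehat{R}_X\neq0).$$ Then there is a Hermitian matrix $X_M$ that is at the same time 1. the maximal Hermitian solution of the conjugate Riccati equation $X=\mathcal{R}(X)$ (i.e. $X_M\in\mathrm{dom}(\mathcal{R})$ is a solution and $X_M\ge X$ for every solution $X\in\mathrm{dom}(\mathcal{R})$), 2. the maximal Hermitian solution of the transformed Riccati equation $X=\widehat{\mathcal{R}}(X)$ (among Hermitian $X$ with $\det\widehat{R}_X\neq0$), and of the same equation in the form $X=\mathcal{R}(\mathcal{R}(X))$ (among $X\in\mathrm{dom}(\mathcal{R})$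 with $\mathcal{R}(X)\in\mathrm{dom}(\mathcal{R})$), and $R_{X_M}>0$, $\widehat{R}_{X_M}>0$. Moreover, let $\mathcal{S}_\ge$ be the set of Hermitian $X$ such that $X-T_W^H\overline{X}T_W\ge H+F_W^HRF_W$ for some $W\in\mathbb{T}$. Then $\mathcal{S}_\ge\neq\emptyset$, and for every $X_0=Y_0\in\mathcal{S}_\ge$ the iterations $X_{k+1}=\mathcal{R}(X_k)$ and $Y_{k+1}=\widehat{\mathcal{R}}(Y_k)$ are well defined ($X_k\in\mathrm{dom}(\mathcal{R})$ and $\det\widehat{R}_{Y_k}\ne 0$ for all $k\ge 0$), $Y_k=X_{2k}$ for all $k\ge0$, $X_k\ge X_{k+1}$ for all $k\ge0$, and $X_k\to X_M$, $Y_k\to X_M$ as $k\to\infty$. -/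

import Mathlib

open scoped ComplexOrder MatrixOrder Matrix

namespace CDARE

noncomputable section

variable {n m : ℕ}

/-- Entrywise complex conjugate `M̄` of a matrix. -/
abbrev bar {ι κ : Type*} (M : Matrix ι κ ℂ) : Matrix ι κ ℂ := M.map star

section Conjugate

variable (A : Matrix (Fin n) (Fin n) ℂ) (B : Matrix (Fin n) (Fin m) ℂ)
  (R : Matrix (Fin m) (Fin m) ℂ) (H : Matrix (Fin n) (Fin n) ℂ)

/-- `R_X = R + Bᴴ X̄ B`. -/
def RX (X : Matrix (Fin n) (Fin n) ℂ) : Matrix (Fin m) (Fin m) ℂ := R + Bᴴ * bar X * B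

/-- The conjugate Riccati operator
`𝓡(X) = Aᴴ X̄ A - Aᴴ X̄ B (R + Bᴴ X̄ B)⁻¹ Bᴴ X̄ A + H`. It is meaningful on `dom B R`. -/
def ric (X : Matrix (Fin n) (Fin n) ℂ) : Matrix (Fin n) (Fin n) ℂ :=
  Aᴴ * bar X * A - Aᴴ * bar X * B * (RX B R X)⁻¹ * (Bᴴ * bar X * A) + H

/-- `dom(𝓡)`: the Hermitian `X` with `R_X` nonsingular. -/
def dom : Set (Matrix (Fin n) (Fin n) ℂ) := {X | X.IsHermitian ∧ (RX B R X).det ≠ 0}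

/-- `F_X = R_X⁻¹ Bᴴ X̄ A`. -/
def FX (X : Matrix (Fin n) (Fin n) ℂ) : Matrix (Fin m) (Fin n) ℂ :=
  (RX B R X)⁻¹ * Bᴴ * bar X * A

/-- The closed-loop matrix `T_X = A - B F_X`. -/
def TX (X : Matrix (Fin n) (Fin n) ℂ) : Matrix (Fin n) (Fin n) ℂ := A - B * FX A B R X

/-- `𝕋`: the `X ∈ dom(𝓡)` such that the spectral radius of `conj(T_X) T_X` is less than one. -/
def stabSet : Set (Matrix (Fin n) (Fin n) ℂ) :=
  {X | X ∈ dom B R ∧ spectralRadius ℂ (bar (TX A B R X) * TX A B R X) < 1}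

/-- `ℙ`: the `X ∈ dom(𝓡)` with `R_X` positive definite. -/
def posSet : Set (Matrix (Fin n) (Fin n) ℂ) := {X | X ∈ dom B R ∧ (RX B R X).PosDef}

/-- `𝓡_≤`: the `X ∈ dom(𝓡)` with `X ≤ 𝓡(X)` in the Loewner order. -/
def subSolutions : Set (Matrix (Fin n) (Fin n) ℂ) := {X | X ∈ dom B R ∧ X ≤ ric A B R H X}

/-- `𝓡_=`: the Hermitian solutions of the CDARE `X = 𝓡(X)`. -/
def solutions : Set (Matrix (Fin n) (Fin n) ℂ) := {X | X ∈ dom B R ∧ X = ric A B R H X}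

/-- The Hermitian solutions of `X = 𝓡(𝓡(X))`, both applications of `𝓡` being defined. -/
def compSolutions : Set (Matrix (Fin n) (Fin n) ℂ) :=
  {X | X ∈ dom B R ∧ ric A B R H X ∈ dom B R ∧ X = ric A B R H (ric A B R H X)}

/-- `𝓢_≥`: the Hermitian `X` for which some `W ∈ 𝕋` satisfies
`X - T_Wᴴ X̄ T_W ≥ H + F_Wᴴ R F_W`. -/
def startSet : Set (Matrix (Fin n) (Fin n) ℂ) :=
  {X | X.IsHermitian ∧ ∃ W ∈ stabSet A B R,
    H + (FX A B R W)ᴴ * R * FX A B R W ≤ X - (TX A B R W)ᴴ * bar X * TX A B R W}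

end Conjugate

section Transformed

variable (A : Matrix (Fin n) (Fin n) ℂ) (B : Matrix (Fin n) (Fin m) ℂ)
  (R : Matrix (Fin m) (Fin m) ℂ) (H : Matrix (Fin n) (Fin n) ℂ)

/-- `Â = Ā A - Ā B R_H⁻¹ Bᴴ H̄ A`. -/
def hatA : Matrix (Fin n) (Fin n) ℂ :=
  bar A * A - bar A * B * (RX B R H)⁻¹ * Bᴴ * bar H * A

/-- `B̂ = [B̄  Ā B]`. -/
def hatB : Matrix (Fin n) (Fin m ⊕ Fin m) ℂ := Matrix.fromCols (bar B) (bar A * B)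

/-- `R̂ = R̄ ⊕ R_H`. -/
def hatR : Matrix (Fin m ⊕ Fin m) (Fin m ⊕ Fin m) ℂ :=
  Matrix.fromBlocks (bar R) 0 0 (RX B R H)

/-- `Ĥ = H + Aᴴ H̄ (I + G H̄)⁻¹ A` with `G = B R⁻¹ Bᴴ`. -/
def hatH : Matrix (Fin n) (Fin n) ℂ :=
  H + Aᴴ * bar H * (1 + B * R⁻¹ * Bᴴ * bar H)⁻¹ * A

/-- `R̂_X = R̂ + B̂ᴴ X B̂`. -/
def hatRX (X : Matrix (Fin n) (Fin n) ℂ) : Matrix (Fin m ⊕ Fin m) (Fin m ⊕ Fin m) ℂ :=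
  hatR B R H + (hatB A B)ᴴ * X * hatB A B

/-- The Riccati operator of the transformed DARE,
`Âᴴ X Â - Âᴴ X B̂ (R̂ + B̂ᴴ X B̂)⁻¹ B̂ᴴ X Â + Ĥ`. It is meaningful on `hatDom A B R H`. -/
def hatRic (X : Matrix (Fin n) (Fin n) ℂ) : Matrix (Fin n) (Fin n) ℂ :=
  (hatA A B R H)ᴴ * X * hatA A B R H
    - (hatA A B R H)ᴴ * X * hatB A B * (hatRX A B R H X)⁻¹ * ((hatB A B)ᴴ * X * hatA A B R H)
    + hatH A B R H

/-- The Hermitian `X` with `R̂_X` nonsingular. -/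
def hatDom : Set (Matrix (Fin n) (Fin n) ℂ) :=
  {X | X.IsHermitian ∧ (hatRX A B R H X).det ≠ 0}

/-- The Hermitian solutions of the transformed DARE. -/
def hatSolutions : Set (Matrix (Fin n) (Fin n) ℂ) :=
  {X | X ∈ hatDom A B R H ∧ X = hatRic A B R H X}

end Transformed

end

end CDARE

namespace CDARE

/-! The transformed operator is `𝓡 ∘ 𝓡` in disguise (`hatRic_eq_ric_ric`). The Schur complement of
`conj(R_X)` in `R̂_X` is `R_{𝓡(X)}`, so `R̂_X > 0` exactly when `R_X > 0` and `R_{𝓡(X)} > 0`.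

Where `R_X > 0`, completing the square exhibits `𝓡(X)` as the minimum over gains `F` of the monotone
affine maps `policy F` at `conj(X)`. Hence `𝓡` is monotone above a subsolution `P` in `ℙ`. If `X₀ ∈
𝓢_≥`, one policy maps `X₀` below itself, so `𝓡(X₀) ≤ X₀`. Applying that policy twice gives a Stein
inequality with the stable matrix `conj(T_W) T_W`, which forces `P ≤ X₀`. The iterates thus
decrease, stay above `P`, and converge to a solution. The same comparison puts every positively
weighted fixed point of `𝓡 ∘ 𝓡` below `X₀`, hence below the even iterates and their limit.

Any solution of the transformed equation is positively weighted, by evaluating the completed square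
on the unit circle (`wt_posDef_of_solution`). The limit therefore bounds all three nested solution
sets. -/

theorem conj_mono {ι κ : Type*} [Fintype ι] [Fintype κ] {X Y : Matrix ι ι ℂ} (h : X ≤ Y) (N : Matrix ι κ ℂ) :
    Nᴴ * X * N ≤ Nᴴ * Y * N := by
  rw [Matrix.le_iff] at *
  have := h.conjTranspose_mul_mul_same N
  rwa [Matrix.mul_sub, Matrix.sub_mul] at this

/-! ### Order intervals, Stein equations and the unit circle -/

section Topology

variable {ι : Type*} [Fintype ι] [DecidableEq ι]

open scoped Matrix.Norms.L2Operator in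
theorem orderClosedTopology_matrix : OrderClosedTopology (Matrix ι ι ℂ) := inferInstance

open scoped Matrix.Norms.L2Operator in
theorem tendsto_pow_of_spectralRadius_lt_one {S : Matrix ι ι ℂ}
    (h : spectralRadius ℂ S < 1) : Filter.Tendsto (fun k : ℕ => S ^ k) Filter.atTop (nhds 0) := by
  obtain ⟨r, hr, hr1⟩ := ENNReal.lt_iff_exists_nnreal_btwn.1 h
  have hr1' : r < 1 := by exact_mod_cast hr1
  have hG := (spectrum.pow_nnnorm_pow_one_div_tendsto_nhds_spectralRadius S).eventually
    (gt_mem_nhds hr)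
  have hle : ∀ᶠ k : ℕ in Filter.atTop, ‖S ^ k‖ ≤ (r : ℝ) ^ k := by
    filter_upwards [hG, Filter.eventually_gt_atTop 0] with k hk hk0
    have hk0' : (0 : ℝ) < k := by exact_mod_cast hk0
    have := ENNReal.rpow_le_rpow hk.le hk0'.le
    rw [← ENNReal.rpow_mul, one_div, inv_mul_cancel₀ hk0'.ne', ENNReal.rpow_one,
      ENNReal.rpow_natCast] at this
    exact_mod_cast this
  exact squeeze_zero_norm' hle (tendsto_pow_atTop_nhds_zero_of_lt_one r.2 hr1')

open scoped Matrix.Norms.L2Operator in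
-- The C*-norm is monotone on positive elements, so order intervals are bounded as well as closed.
theorem isCompact_Icc_matrix (P Q : Matrix ι ι ℂ) : IsCompact (Set.Icc P Q) := by
  have : ProperSpace (Matrix ι ι ℂ) := FiniteDimensional.proper ℂ _
  refine Metric.isCompact_of_isClosed_isBounded isClosed_Icc ?_
  refine (Metric.isBounded_closedBall (x := P) (r := ‖Q - P‖)).subset fun X hX => ?_
  rw [mem_closedBall_iff_norm]
  exact CStarAlgebra.norm_le_norm_of_nonneg_of_le (sub_nonneg.2 hX.1) (sub_le_sub_right hX.2 P)

/-- An antitone sequence of matrices that is bounded below in the Loewner order converges. -/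
theorem exists_tendsto_of_antitone {f : ℕ → Matrix ι ι ℂ} {P : Matrix ι ι ℂ}
    (hf : Antitone f) (hP : ∀ k, P ≤ f k) :
    ∃ L, Filter.Tendsto f Filter.atTop (nhds L) := by
  have := orderClosedTopology_matrix (ι := ι)
  have hmem : ∀ k, f k ∈ Set.Icc P (f 0) := fun k => ⟨hP k, hf (Nat.zero_le k)⟩
  have hK := isCompact_Icc_matrix P (f 0)
  -- Every cluster point lies below every term, hence below every other cluster point; by
  -- antisymmetry there is only one.
  have hcl : ∀ y, MapClusterPt y Filter.atTop f → ∀ k, y ≤ f k := fun y hy k =>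
    (isClosed_Iic (a := f k)).mem_of_mapClusterPt hy
      ((Filter.eventually_ge_atTop k).mono fun j hj => hf hj)
  have hle : ∀ y, MapClusterPt y Filter.atTop f → ∀ L, MapClusterPt L Filter.atTop f → y ≤ L :=
    fun y hy L hL => (isClosed_Ici (a := y)).mem_of_mapClusterPt hL (.of_forall (hcl y hy))
  obtain ⟨L, -, hL⟩ := hK.exists_mapClusterPt_of_frequently (l := Filter.atTop) (f := f)
    (Filter.Frequently.of_forall hmem)
  exact ⟨L, hK.tendsto_nhds_of_unique_mapClusterPt (.of_forall hmem)
    fun y _ hy => le_antisymm (hle y hy L hL) (hle L hL y hy)⟩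

theorem conj_tendsto_zero {S : Matrix ι ι ℂ} (h : spectralRadius ℂ S < 1) (D : Matrix ι ι ℂ) :
    Filter.Tendsto (fun k : ℕ => (S ^ k)ᴴ * D * S ^ k) Filter.atTop (nhds 0) := by
  have hS := tendsto_pow_of_spectralRadius_lt_one h
  have hc : Continuous fun M : Matrix ι ι ℂ => Mᴴ * D * M := by fun_prop
  have h0 := (hc.tendsto 0).comp hS
  rwa [Matrix.mul_zero] at h0

/-- Iterating the inequality bounds `D` below by `(S ^ k)ᴴ * D * S ^ k`, which tends to zero. -/
theorem nonneg_of_stein_le {S D : Matrix ι ι ℂ} (h : spectralRadius ℂ S < 1)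
    (hD : Sᴴ * D * S ≤ D) : 0 ≤ D := by
  have := orderClosedTopology_matrix (ι := ι)
  have hk : ∀ k : ℕ, (S ^ k)ᴴ * D * S ^ k ≤ D := by
    intro k
    induction k with
    | zero => simp
    | succ k ih =>
      refine le_trans ?_ ((conj_mono ih S).trans hD)
      rw [pow_succ, Matrix.conjTranspose_mul]
      simp only [Matrix.mul_assoc, le_refl]
  exact le_of_tendsto (conj_tendsto_zero h D) (.of_forall hk)

/-- Decay of the powers of `S` makes the Stein map injective, hence surjective in finite dimension;
injectivity also makes the solution Hermitian. -/
theorem exists_stein_solution {S : Matrix ι ι ℂ} (h : spectralRadius ℂ S < 1)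
    {Q : Matrix ι ι ℂ} (hQ : Q.IsHermitian) :
    ∃ X : Matrix ι ι ℂ, X.IsHermitian ∧ X - Sᴴ * X * S = Q := by
  let f : Matrix ι ι ℂ →ₗ[ℂ] Matrix ι ι ℂ :=
    { toFun := fun X => X - Sᴴ * X * S
      map_add' := fun X Y => by simp only [Matrix.mul_add, Matrix.add_mul]; abel
      map_smul' := fun c X => by simp [smul_sub] }
  have hinj : Function.Injective f := by
    rw [← LinearMap.ker_eq_bot, LinearMap.ker_eq_bot']
    intro X hX
    have hX' : Sᴴ * X * S = X := (sub_eq_zero.1 hX).symm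
    have hk : ∀ k : ℕ, (S ^ k)ᴴ * X * S ^ k = X := by
      intro k
      induction k with
      | zero => simp
      | succ k ih =>
        rw [pow_succ, Matrix.conjTranspose_mul]
        calc _ = Sᴴ * ((S ^ k)ᴴ * X * S ^ k) * S := by simp only [Matrix.mul_assoc]
          _ = X := by rw [ih, hX']
    have := conj_tendsto_zero h X
    simp only [hk] at this
    exact tendsto_nhds_unique tendsto_const_nhds this
  obtain ⟨X, hX⟩ := LinearMap.injective_iff_surjective.1 hinj Q
  have hXH : f Xᴴ = Q := by
    have := congrArg Matrix.conjTranspose hX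
    rw [hQ.eq] at this
    rw [← this]
    simp [f, Matrix.mul_assoc]
  exact ⟨X, hinj (hXH.trans hX.symm), hX⟩

theorem exists_unit_circle_det_ne_zero (T : Matrix ι ι ℂ) :
    ∃ z : ℂ, star z * z = 1 ∧ (z • (1 : Matrix ι ι ℂ) - T).det ≠ 0 := by
  have hinf : (Metric.sphere (0 : ℂ) 1).Infinite :=
    (isPreconnected_sphere (by simp) 0 1).infinite_of_nontrivial
      ⟨1, by simp, -1, by simp, by norm_num⟩
  obtain ⟨z, hz, hzr⟩ := hinf.exists_notMem_finset T.charpoly.roots.toFinset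
  refine ⟨z, ?_, fun h0 => hzr ?_⟩
  · have hz1 : ‖z‖ = 1 := by simpa using hz
    rw [Complex.star_def, mul_comm, Complex.mul_conj, Complex.normSq_eq_norm_sq, hz1]
    simp
  · rw [Multiset.mem_toFinset, Polynomial.mem_roots (Matrix.charpoly_monic T).ne_zero,
      Polynomial.IsRoot, Matrix.eval_charpoly, ← h0, Matrix.smul_one_eq_diagonal]
    rfl

end Topology

/-! ### The unconjugated Riccati operator -/

section Plain

variable {ι κ μ : Type*} [Fintype ι]

/-- `R + Bᴴ X B`, the weight of the unconjugated Riccati operator. -/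
def wt (B : Matrix ι κ ℂ) (R : Matrix κ κ ℂ) (X : Matrix ι ι ℂ) : Matrix κ κ ℂ :=
  R + Bᴴ * X * B

theorem wt_isHermitian {B : Matrix ι κ ℂ} {R : Matrix κ κ ℂ} {X : Matrix ι ι ℂ}
    (hR : R.IsHermitian) (hX : X.IsHermitian) : (wt B R X).IsHermitian :=
  hR.add (Matrix.isHermitian_conjTranspose_mul_mul B hX)

variable [Fintype κ]

/-- The affine operator `X ↦ (A - B F)ᴴ X (A - B F) + (H + Fᴴ R F)` of a fixed gain `F`. -/
def policy (A : Matrix ι ι ℂ) (B : Matrix ι κ ℂ) (R : Matrix κ κ ℂ)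
    (H : Matrix ι ι ℂ) (F : Matrix κ ι ℂ) (X : Matrix ι ι ℂ) : Matrix ι ι ℂ :=
  (A - B * F)ᴴ * X * (A - B * F) + (H + Fᴴ * R * F)

theorem conj_nonneg [Fintype μ] {W : Matrix κ κ ℂ} (hW : W.PosSemidef) (N : Matrix κ μ ℂ) :
    0 ≤ Nᴴ * W * N := (hW.conjTranspose_mul_mul_same N).nonneg

variable {A : Matrix ι ι ℂ} {B : Matrix ι κ ℂ} {R : Matrix κ κ ℂ} {H X Y : Matrix ι ι ℂ}

theorem policy_mono (h : X ≤ Y) (F : Matrix κ ι ℂ) :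
    policy A B R H F X ≤ policy A B R H F Y :=
  add_le_add_left (conj_mono h _) _

theorem wt_posDef_mono (hp : (wt B R X).PosDef) (h : X ≤ Y) :
    (wt B R Y).PosDef := by
  have : wt B R Y = wt B R X + Bᴴ * (Y - X) * B := by
    simp only [wt, Matrix.mul_sub, Matrix.sub_mul]; abel
  rw [this]
  exact hp.add_posSemidef ((Matrix.le_iff.1 h).conjTranspose_mul_mul_same B)

variable [DecidableEq κ]

/-- The feedback gain `(R + Bᴴ X B)⁻¹ Bᴴ X A`. -/
noncomputable def gain (A : Matrix ι ι ℂ) (B : Matrix ι κ ℂ) (R : Matrix κ κ ℂ)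
    (X : Matrix ι ι ℂ) : Matrix κ ι ℂ :=
  (wt B R X)⁻¹ * (Bᴴ * X * A)

/-- The unconjugated Riccati operator. -/
noncomputable def dric (A : Matrix ι ι ℂ) (B : Matrix ι κ ℂ) (R : Matrix κ κ ℂ)
    (H X : Matrix ι ι ℂ) : Matrix ι ι ℂ :=
  Aᴴ * X * A - Aᴴ * X * B * (wt B R X)⁻¹ * (Bᴴ * X * A) + H

theorem dric_eq (A : Matrix ι ι ℂ) (B : Matrix ι κ ℂ) (R : Matrix κ κ ℂ) (H X : Matrix ι ι ℂ) :
    dric A B R H X = Aᴴ * X * (A - B * gain A B R X) + H := by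
  simp only [dric, gain, Matrix.mul_sub, Matrix.mul_assoc]

theorem wt_mul_gain (hd : (wt B R X).det ≠ 0) :
    wt B R X * gain A B R X = Bᴴ * X * A := by
  rw [gain, Matrix.mul_nonsing_inv_cancel_left _ _ (isUnit_iff_ne_zero.2 hd)]

theorem gain_mul_wt (hR : R.IsHermitian) (hX : X.IsHermitian) (hd : (wt B R X).det ≠ 0) :
    (gain A B R X)ᴴ * wt B R X = Aᴴ * X * B := by
  have := congrArg Matrix.conjTranspose (wt_mul_gain (A := A) hd)
  simpa [(wt_isHermitian hR hX).eq, hX.eq, Matrix.mul_assoc] using this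

/-- The state `N` and input `U` stay arbitrary because two choices matter: `N = 1`, `U = -F` gives
the policy comparison, and a transfer function for `N` gives positivity of the weight. -/
theorem completion_of_squares (hR : R.IsHermitian) (hX : X.IsHermitian)
    (hd : (wt B R X).det ≠ 0) (N : Matrix ι μ ℂ) (U : Matrix κ μ ℂ) :
    Nᴴ * H * N + Uᴴ * R * U + (A * N + B * U)ᴴ * X * (A * N + B * U) =
      Nᴴ * dric A B R H X * N +
        (U + gain A B R X * N)ᴴ * wt B R X * (U + gain A B R X * N) := by
  have h1 := wt_mul_gain (A := A) hd
  have h2 := gain_mul_wt (A := A) hR hX hd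
  have h3 : (U + gain A B R X * N)ᴴ * wt B R X * (U + gain A B R X * N) =
      Uᴴ * wt B R X * U + Uᴴ * (wt B R X * gain A B R X) * N +
        Nᴴ * ((gain A B R X)ᴴ * wt B R X) * U +
        Nᴴ * ((gain A B R X)ᴴ * wt B R X) * gain A B R X * N := by
    simp only [Matrix.conjTranspose_add, Matrix.conjTranspose_mul, Matrix.mul_add,
      Matrix.add_mul, Matrix.mul_assoc]
    abel
  rw [h3, h1, h2, dric_eq, wt]
  simp only [Matrix.conjTranspose_add, Matrix.conjTranspose_mul, Matrix.mul_add,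
    Matrix.add_mul, Matrix.mul_sub, Matrix.sub_mul, Matrix.mul_assoc]
  abel

theorem policy_eq [DecidableEq ι] (hR : R.IsHermitian) (hX : X.IsHermitian)
    (hd : (wt B R X).det ≠ 0) (F : Matrix κ ι ℂ) :
    policy A B R H F X = dric A B R H X +
      (gain A B R X - F)ᴴ * wt B R X * (gain A B R X - F) := by
  have h := completion_of_squares (A := A) (H := H) hR hX hd (1 : Matrix ι ι ℂ) (-F)
  simp only [Matrix.mul_one, Matrix.conjTranspose_one, Matrix.one_mul, Matrix.mul_neg,
    Matrix.conjTranspose_neg, Matrix.neg_mul, neg_neg, ← sub_eq_add_neg, neg_add_eq_sub] at h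
  rw [← h, policy, add_comm]

theorem dric_eq_policy [DecidableEq ι] (hR : R.IsHermitian) (hX : X.IsHermitian)
    (hd : (wt B R X).det ≠ 0) :
    dric A B R H X = policy A B R H (gain A B R X) X := by
  rw [policy_eq hR hX hd]; simp

theorem dric_isHermitian [DecidableEq ι] (hR : R.IsHermitian) (hH : H.IsHermitian)
    (hX : X.IsHermitian) (hd : (wt B R X).det ≠ 0) : (dric A B R H X).IsHermitian := by
  rw [dric_eq_policy hR hX hd]
  exact (Matrix.isHermitian_conjTranspose_mul_mul _ hX).add
    (hH.add (Matrix.isHermitian_conjTranspose_mul_mul _ hR))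

theorem dric_le_policy [DecidableEq ι] (hR : R.IsHermitian) (hX : X.IsHermitian)
    (hp : (wt B R X).PosDef) (F : Matrix κ ι ℂ) :
    dric A B R H X ≤ policy A B R H F X := by
  rw [policy_eq hR hX hp.det_pos.ne']
  exact le_add_of_nonneg_right (conj_nonneg hp.posSemidef _)

/-- The gain optimal for `Y` is merely admissible for `X`, and a policy with fixed gain is monotone.
-/
theorem dric_mono [DecidableEq ι] (hR : R.IsHermitian) (hX : X.IsHermitian)
    (hY : Y.IsHermitian) (hp : (wt B R X).PosDef) (h : X ≤ Y) :
    dric A B R H X ≤ dric A B R H Y := by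
  rw [dric_eq_policy hR hY (wt_posDef_mono hp h).det_pos.ne']
  exact (dric_le_policy hR hX hp _).trans (policy_mono h _)

/-- The difference of two values of the Riccati operator. -/
theorem dric_sub_dric (hR : R.IsHermitian) (hX : X.IsHermitian)
    (hdX : (wt B R X).det ≠ 0) (hdY : (wt B R Y).det ≠ 0) :
    Aᴴ * Y * (A - B * gain A B R Y) - Aᴴ * X * (A - B * gain A B R X) =
      (A - B * gain A B R X)ᴴ * (Y - X) * (A - B * gain A B R Y) := by
  have h1 := wt_mul_gain (A := A) hdY
  have h2 := gain_mul_wt (A := A) hR hX hdX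
  have h2' := wt_mul_gain (A := A) hdX
  set F := gain A B R X
  set G := gain A B R Y
  have e1 : Fᴴ * (Bᴴ * Y * A) = Fᴴ * R * G + Fᴴ * Bᴴ * Y * B * G := by
    rw [← h1, wt]; simp only [Matrix.add_mul, Matrix.mul_add, Matrix.mul_assoc]
  have e2 : Aᴴ * X * B * G = Fᴴ * R * G + Fᴴ * Bᴴ * X * B * G := by
    rw [← h2, wt]; simp only [Matrix.add_mul, Matrix.mul_add, Matrix.mul_assoc]
  have e3 : Aᴴ * X * B * F = Fᴴ * (Bᴴ * X * A) := by
    rw [← h2, ← h2']; simp only [Matrix.mul_assoc]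
  simp only [Matrix.mul_sub, Matrix.sub_mul, Matrix.conjTranspose_sub, Matrix.conjTranspose_mul,
    Matrix.mul_assoc] at *
  rw [e1, e2, e3]
  abel

/-- If the Riccati inequality has a solution with positive definite weight, then every solution
of the Riccati equation has a positive definite weight. -/
theorem wt_posDef_of_solution [DecidableEq ι] (hR : R.IsHermitian) (hX : X.IsHermitian)
    (hY : Y.IsHermitian) (hpY : (wt B R Y).PosDef) (hsub : Y ≤ dric A B R H Y)
    (hdX : (wt B R X).det ≠ 0) (hsol : X = dric A B R H X) : (wt B R X).PosDef := by
  obtain ⟨z, hz, hdz⟩ := exists_unit_circle_det_ne_zero (A - B * gain A B R X)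
  set F := gain A B R X
  -- `N` is the closed-loop transfer function at `z`: under the input `1 - F * N` the state `N`
  -- moves to `z • N`. As `|z| = 1`, this leaves every form `Nᴴ * Z * N` unchanged.
  set N : Matrix ι κ ℂ := (z • (1 : Matrix ι ι ℂ) - (A - B * F))⁻¹ * B
  have hzN : A * N + B * (1 - F * N) = z • N := by
    have h : (z • (1 : Matrix ι ι ℂ) - (A - B * F)) * N = B :=
      Matrix.mul_nonsing_inv_cancel_left _ _ (isUnit_iff_ne_zero.2 hdz)
    simp only [Matrix.sub_mul, Matrix.smul_mul, Matrix.one_mul] at h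
    rw [sub_eq_iff_eq_add.1 h, Matrix.mul_sub, Matrix.mul_one, Matrix.mul_assoc]
    abel
  have hc : ∀ Z : Matrix ι ι ℂ, (z • N)ᴴ * Z * (z • N) = Nᴴ * Z * N := by
    intro Z
    rw [Matrix.conjTranspose_smul, Matrix.smul_mul, Matrix.smul_mul, Matrix.mul_smul, smul_smul,
      hz, one_smul]
  have eX := completion_of_squares (A := A) (H := H) hR hX hdX N (1 - F * N)
  have eY := completion_of_squares (A := A) (H := H) hR hY hpY.det_pos.ne' N (1 - F * N)
  rw [hzN, hc] at eX eY
  -- The shifted input `1 - F * N + F * N` is `1`, so the square for `X` is the weight itself; the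
  -- terms in `X` cancel and the weight equals the stage cost.
  rw [← hsol, add_comm, sub_add_cancel, Matrix.conjTranspose_one, Matrix.one_mul,
    Matrix.mul_one, add_right_inj] at eX
  have hle : Nᴴ * Y * N ≤ Nᴴ * dric A B R H Y * N := conj_mono hsub N
  have hnn := conj_nonneg hpY.posSemidef (1 - F * N + gain A B R Y * N)
  have h0 : 0 ≤ wt B R X := by
    rw [← eX]
    have := add_le_add hle hnn
    rw [← eY, add_zero, add_comm] at this
    exact (le_add_iff_nonneg_right _).1 this
  exact (Matrix.PosSemidef.posDef_iff_det_ne_zero (Matrix.nonneg_iff_posSemidef.1 h0)).2 hdX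

end Plain

/-! ### Entrywise conjugation -/

section Bar

variable {ι κ μ : Type*}

theorem bar_mul [Fintype κ] (M : Matrix ι κ ℂ) (N : Matrix κ μ ℂ) :
    bar (M * N) = bar M * bar N := Matrix.map_mul (f := starRingEnd ℂ)

theorem bar_add (M N : Matrix ι κ ℂ) : bar (M + N) = bar M + bar N := by
  ext; simp

theorem bar_sub (M N : Matrix ι κ ℂ) : bar (M - N) = bar M - bar N := by
  ext; simp

theorem bar_conjTranspose (M : Matrix ι κ ℂ) : bar Mᴴ = (bar M)ᴴ := rfl

theorem bar_bar (M : Matrix ι κ ℂ) : bar (bar M) = M := by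
  ext; simp

theorem bar_eq_transpose {M : Matrix ι ι ℂ} (h : M.IsHermitian) : bar M = Mᵀ := by
  conv_lhs => rw [← h.eq]
  ext; simp

theorem bar_isHermitian {M : Matrix ι ι ℂ} (h : M.IsHermitian) : (bar M).IsHermitian := by
  rw [bar_eq_transpose h]; exact h.transpose

theorem bar_posSemidef {M : Matrix ι ι ℂ} (h : M.PosSemidef) : (bar M).PosSemidef := by
  rw [bar_eq_transpose h.1]; exact h.transpose

theorem bar_posDef {M : Matrix ι ι ℂ} (h : M.PosDef) : (bar M).PosDef := by
  rw [bar_eq_transpose h.1]; exact h.transpose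

theorem bar_mono {M N : Matrix ι ι ℂ} (h : M ≤ N) : bar M ≤ bar N := by
  rw [Matrix.le_iff] at *
  rw [← bar_sub]; exact bar_posSemidef h

theorem det_bar [Fintype ι] [DecidableEq ι] (M : Matrix ι ι ℂ) : (bar M).det = star M.det :=
  ((starRingEnd ℂ).map_det M).symm

theorem bar_inv [Fintype ι] [DecidableEq ι] (M : Matrix ι ι ℂ) : bar M⁻¹ = (bar M)⁻¹ := by
  have h : ∀ N : Matrix ι ι ℂ, bar N = Nᴴᵀ := fun N => rfl
  rw [h, h, Matrix.conjTranspose_nonsing_inv, Matrix.transpose_nonsing_inv]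

end Bar

/-! ### The transformed operator as two steps of `𝓡` -/

section Doubling

variable {n m : ℕ} {A : Matrix (Fin n) (Fin n) ℂ} {B : Matrix (Fin n) (Fin m) ℂ}
  {R : Matrix (Fin m) (Fin m) ℂ} {H X : Matrix (Fin n) (Fin n) ℂ}

theorem FX_eq_gain (A : Matrix (Fin n) (Fin n) ℂ) (B : Matrix (Fin n) (Fin m) ℂ)
    (R : Matrix (Fin m) (Fin m) ℂ) (X : Matrix (Fin n) (Fin n) ℂ) :
    FX A B R X = gain A B R (bar X) := by
  simp only [FX, gain, RX, wt, Matrix.mul_assoc]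

theorem TX_eq (A : Matrix (Fin n) (Fin n) ℂ) (B : Matrix (Fin n) (Fin m) ℂ)
    (R : Matrix (Fin m) (Fin m) ℂ) (X : Matrix (Fin n) (Fin n) ℂ) :
    TX A B R X = A - B * gain A B R (bar X) := by
  rw [TX, FX_eq_gain]

theorem ric_eq (A : Matrix (Fin n) (Fin n) ℂ) (B : Matrix (Fin n) (Fin m) ℂ)
    (R : Matrix (Fin m) (Fin m) ℂ) (H X : Matrix (Fin n) (Fin n) ℂ) :
    ric A B R H X = Aᴴ * bar X * TX A B R X + H := by
  rw [TX_eq]; exact dric_eq A B R H (bar X)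

theorem R_mul_FX (hd : (RX B R X).det ≠ 0) :
    R * FX A B R X = Bᴴ * bar X * TX A B R X := by
  have h : (R + Bᴴ * bar X * B) * FX A B R X = Bᴴ * bar X * A := by
    rw [FX_eq_gain]; exact wt_mul_gain hd
  rw [TX, Matrix.mul_sub, ← h, Matrix.add_mul]
  simp only [Matrix.mul_assoc, add_sub_cancel_right]

theorem hatA_eq (A : Matrix (Fin n) (Fin n) ℂ) (B : Matrix (Fin n) (Fin m) ℂ)
    (R : Matrix (Fin m) (Fin m) ℂ) (H : Matrix (Fin n) (Fin n) ℂ) :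
    hatA A B R H = bar A * TX A B R H := by
  simp only [hatA, TX, FX, Matrix.mul_sub, Matrix.mul_assoc]

theorem hatH_eq (hRdet : R.det ≠ 0) (hRH : (RX B R H).det ≠ 0) :
    hatH A B R H = ric A B R H H := by
  have hR : IsUnit R.det := isUnit_iff_ne_zero.2 hRdet
  have hdet : (1 + B * R⁻¹ * Bᴴ * bar H).det ≠ 0 := by
    have h : RX B R H = R * (1 + R⁻¹ * (Bᴴ * bar H * B)) := by
      rw [Matrix.mul_add, Matrix.mul_one, Matrix.mul_nonsing_inv_cancel_left _ _ hR, RX]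
    have h' : (1 + B * R⁻¹ * Bᴴ * bar H).det = (1 + R⁻¹ * (Bᴴ * bar H * B)).det := by
      have := Matrix.det_one_add_mul_comm B (R⁻¹ * (Bᴴ * bar H))
      simpa only [Matrix.mul_assoc] using this
    rw [h']
    rw [h, Matrix.det_mul] at hRH
    exact right_ne_zero_of_mul hRH
  -- This identifies `(I + G H̄)⁻¹ A` with the closed-loop matrix `T_H`, since `R⁻¹ Bᴴ H̄ T_H =
  -- F_H`.
  have hmul : (1 + B * R⁻¹ * Bᴴ * bar H) * TX A B R H = A := by
    have h1 := congrArg (R⁻¹ * ·) (R_mul_FX (A := A) hRH)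
    simp only [Matrix.nonsing_inv_mul_cancel_left _ _ hR] at h1
    have h2 : (1 + B * R⁻¹ * Bᴴ * bar H) * TX A B R H =
        TX A B R H + B * (R⁻¹ * (Bᴴ * bar H * TX A B R H)) := by
      simp only [Matrix.add_mul, Matrix.one_mul, Matrix.mul_assoc]
    rw [h2, ← h1, TX, sub_add_cancel]
  rw [ric_eq, hatH, add_comm]
  have hinv : (1 + B * R⁻¹ * Bᴴ * bar H)⁻¹ * A = TX A B R H :=
    calc _ = (1 + B * R⁻¹ * Bᴴ * bar H)⁻¹ *
          ((1 + B * R⁻¹ * Bᴴ * bar H) * TX A B R H) := by rw [hmul]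
      _ = _ := Matrix.nonsing_inv_mul_cancel_left _ _ (isUnit_iff_ne_zero.2 hdet)
  rw [Matrix.mul_assoc, hinv]

theorem hatRX_eq_fromBlocks (hX : X.IsHermitian) :
    hatRX A B R H X = Matrix.fromBlocks (bar (RX B R X)) ((bar B)ᴴ * X * (bar A * B))
      ((bar B)ᴴ * X * (bar A * B))ᴴ (RX B R H + (bar A * B)ᴴ * X * (bar A * B)) := by
  rw [hatRX, hatR, hatB, Matrix.conjTranspose_fromCols_eq_fromRows_conjTranspose,
    Matrix.fromRows_mul, Matrix.fromRows_mul_fromCols, Matrix.fromBlocks_add]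
  congr 1
  · rw [RX, bar_add, bar_mul, bar_mul, bar_bar, bar_conjTranspose]
  · rw [zero_add]
  · rw [zero_add]
    simp only [Matrix.conjTranspose_mul, hX.eq, Matrix.conjTranspose_conjTranspose,
      Matrix.mul_assoc]

/-- Eliminating the first input block performs the inner application of `𝓡`; determinant and
definiteness of `R̂_X` then split over the two steps. -/
theorem schur_complement_hatRX (hX : X.IsHermitian) :
    (RX B R H + (bar A * B)ᴴ * X * (bar A * B)) -
      ((bar B)ᴴ * X * (bar A * B))ᴴ * (bar (RX B R X))⁻¹ * ((bar B)ᴴ * X * (bar A * B)) =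
      RX B R (ric A B R H X) := by
  rw [RX, RX.eq_def B R (ric A B R H X), ric]
  simp only [bar_add, bar_sub, bar_mul, bar_bar, bar_conjTranspose, bar_inv,
    Matrix.conjTranspose_mul, hX.eq, Matrix.conjTranspose_conjTranspose,
    Matrix.mul_add, Matrix.add_mul, Matrix.mul_sub, Matrix.sub_mul, Matrix.mul_assoc]
  abel

theorem det_hatRX (hX : X ∈ dom B R) :
    (hatRX A B R H X).det = star (RX B R X).det * (RX B R (ric A B R H X)).det := by
  have hu : (bar (RX B R X)).det ≠ 0 := by rw [det_bar]; simpa using hX.2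
  let := Matrix.invertibleOfIsUnitDet _ (isUnit_iff_ne_zero.2 hu)
  rw [hatRX_eq_fromBlocks hX.1, Matrix.det_fromBlocks₁₁, Matrix.invOf_eq_nonsing_inv,
    schur_complement_hatRX hX.1, det_bar]

theorem hatRX_posDef (hX : X.IsHermitian) (h1 : (RX B R X).PosDef)
    (h2 : (RX B R (ric A B R H X)).PosDef) : (hatRX A B R H X).PosDef := by
  have hb := bar_posDef h1
  let := Matrix.invertibleOfIsUnitDet _ (isUnit_iff_ne_zero.2 hb.det_pos.ne')
  refine (Matrix.PosSemidef.posDef_iff_det_ne_zero ?_).2 ?_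
  · rw [hatRX_eq_fromBlocks hX, Matrix.PosDef.fromBlocks₁₁ _ _ hb, schur_complement_hatRX hX]
    exact h2.posSemidef
  · rw [det_hatRX ⟨hX, h1.det_pos.ne'⟩]
    exact mul_ne_zero (by simpa using h1.det_pos.ne') h2.det_pos.ne'

theorem RX_posDef_of_hatRX_posDef (hX : X.IsHermitian) (h : (hatRX A B R H X).PosDef) :
    (RX B R X).PosDef ∧ (RX B R (ric A B R H X)).PosDef := by
  have hb : (bar (RX B R X)).PosDef := by
    have := h.submatrix Sum.inl_injective
    rwa [hatRX_eq_fromBlocks hX] at this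
  have h1 : (RX B R X).PosDef := by simpa only [bar_bar] using bar_posDef hb
  refine ⟨h1, ?_⟩
  let := Matrix.invertibleOfIsUnitDet _ (isUnit_iff_ne_zero.2 hb.det_pos.ne')
  have hd := h.det_pos.ne'
  rw [det_hatRX ⟨hX, h1.det_pos.ne'⟩] at hd
  refine (Matrix.PosSemidef.posDef_iff_det_ne_zero ?_).2 (right_ne_zero_of_mul hd)
  have hp := h.posSemidef
  rwa [hatRX_eq_fromBlocks hX, Matrix.PosDef.fromBlocks₁₁ _ _ hb, schur_complement_hatRX hX] at hp

/-- On the domain of `𝓡 ∘ 𝓡` the transformed Riccati operator is `𝓡 ∘ 𝓡`. -/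
theorem hatRic_eq_ric_ric (hR : R.IsHermitian) (hRdet : R.det ≠ 0) (hH : H.IsHermitian)
    (hRH : (RX B R H).det ≠ 0) (hX : X ∈ dom B R) (hY : ric A B R H X ∈ dom B R) :
    hatRic A B R H X = ric A B R H (ric A B R H X) := by
  have hYric : ric A B R H X = Aᴴ * bar X * TX A B R X + H := ric_eq A B R H X
  set Y := ric A B R H X
  have hdet : IsUnit (hatRX A B R H X).det := by
    rw [det_hatRX hX]
    exact isUnit_iff_ne_zero.2 (mul_ne_zero (by simpa using hX.2) hY.2)
  have hgX := R_mul_FX (A := A) hX.2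
  have hgY := R_mul_FX (A := A) hY.2
  have hgH := R_mul_FX (A := A) hRH
  have hYH : (bar A)ᴴ * X * bar (TX A B R X) = bar Y - bar H := by
    rw [← bar_sub, hYric, add_sub_cancel_right, bar_mul, bar_mul, bar_bar, bar_conjTranspose]
  -- `K` is the candidate for the transformed gain. Its second block is only the deviation from
  -- `F_H`, because `Â = Ā T_H` already contains that feedback; its first block applies `conj(F_X)`
  -- after the step `T_Y`.
  set K : Matrix (Fin m ⊕ Fin m) (Fin n) ℂ :=
    Matrix.fromRows (bar (FX A B R X) * TX A B R Y) (FX A B R Y - FX A B R H) with hK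
  have hT : TX A B R H - B * (FX A B R Y - FX A B R H) = TX A B R Y := by
    simp only [TX, Matrix.mul_sub]; abel
  have hloop : hatA A B R H - hatB A B * K = bar (TX A B R X) * TX A B R Y := by
    rw [hatA_eq, hatB, hK, Matrix.fromCols_mul_fromRows, TX.eq_def A B R X, bar_sub, bar_mul,
      Matrix.sub_mul, ← hT]
    simp only [Matrix.mul_sub, Matrix.mul_assoc]
    abel
  have hgain : hatRX A B R H X * K = (hatB A B)ᴴ * X * hatA A B R H := by
    have h : hatR B R H * K = (hatB A B)ᴴ * X * (hatA A B R H - hatB A B * K) := by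
      rw [hloop, hatR, hK, Matrix.fromBlocks_mul_fromRows, hatB,
        Matrix.conjTranspose_fromCols_eq_fromRows_conjTranspose, Matrix.fromRows_mul,
        Matrix.fromRows_mul]
      congr 1
      · have h1 := congrArg bar hgX
        simp only [bar_mul, bar_bar, bar_conjTranspose] at h1
        rw [Matrix.zero_mul, add_zero, ← Matrix.mul_assoc, h1, Matrix.mul_assoc _ _ (TX A B R Y)]
      · have h2 : (bar A * B)ᴴ * X * (bar (TX A B R X) * TX A B R Y) =
            Bᴴ * ((bar A)ᴴ * X * bar (TX A B R X)) * TX A B R Y := by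
          simp only [Matrix.conjTranspose_mul, Matrix.mul_assoc]
        rw [h2, hYH, Matrix.zero_mul, zero_add, Matrix.mul_sub, RX, Matrix.add_mul,
          Matrix.add_mul, hgY, hgH]
        simp only [TX, Matrix.mul_sub, Matrix.sub_mul, Matrix.mul_assoc]
        abel
    rw [hatRX, Matrix.add_mul, h, Matrix.mul_sub]
    simp only [Matrix.mul_assoc, sub_add_cancel]
  have hKeq : (hatRX A B R H X)⁻¹ * ((hatB A B)ᴴ * X * hatA A B R H) = K := by
    rw [← hgain, Matrix.nonsing_inv_mul_cancel_left _ _ hdet]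
  have h1 : hatRic A B R H X = (hatA A B R H)ᴴ * X * (hatA A B R H - hatB A B * K)
      + hatH A B R H := by
    rw [← hKeq, hatRic]; simp only [Matrix.mul_sub, Matrix.mul_assoc]
  -- Comparing `Y` with `H` gives `𝓡(Y) - 𝓡(H) = T_Hᴴ (Ȳ - H̄) T_Y`; substituting `hYH` turns this
  -- into `Âᴴ X conj(T_X) T_Y`, and `Ĥ = 𝓡(H)`.
  have h2 := dric_sub_dric (A := A) hR (bar_isHermitian hH) hRH hY.2
  rw [← TX_eq, ← TX_eq, ← hYH] at h2
  rw [h1, hloop, hatH_eq hRdet hRH, ric_eq A B R H Y, ric_eq A B R H H, hatA_eq,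
    sub_eq_iff_eq_add.1 h2]
  simp only [Matrix.conjTranspose_mul, Matrix.mul_assoc, add_assoc]

end Doubling

/-! ### Monotone iteration and comparison of solutions -/

section Iteration

variable {n m : ℕ} {A : Matrix (Fin n) (Fin n) ℂ} {B : Matrix (Fin n) (Fin m) ℂ}
  {R : Matrix (Fin m) (Fin m) ℂ} {H X Y P Z : Matrix (Fin n) (Fin n) ℂ}

theorem isHermitian_of_le (hX : X.IsHermitian) (h : X ≤ Y) : Y.IsHermitian := by
  have := hX.add (Matrix.le_iff.1 h).isHermitian
  rwa [add_sub_cancel] at this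

theorem RX_posDef_mono (hp : (RX B R X).PosDef) (h : X ≤ Y) : (RX B R Y).PosDef :=
  wt_posDef_mono hp (bar_mono h)

theorem ric_isHermitian (hR : R.IsHermitian) (hH : H.IsHermitian) (hX : X ∈ dom B R) :
    (ric A B R H X).IsHermitian :=
  dric_isHermitian hR hH (bar_isHermitian hX.1) hX.2

theorem ric_mono (hR : R.IsHermitian) (hX : X.IsHermitian) (hp : (RX B R X).PosDef)
    (h : X ≤ Y) : ric A B R H X ≤ ric A B R H Y :=
  dric_mono hR (bar_isHermitian hX) (bar_isHermitian (isHermitian_of_le hX h)) hp (bar_mono h)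

theorem continuousAt_ric (hd : (RX B R X).det ≠ 0) : ContinuousAt (ric A B R H) X := by
  have hb : Continuous fun X : Matrix (Fin n) (Fin n) ℂ => bar X :=
    continuous_id.matrix_map continuous_star
  have hw : Continuous (RX B R) := by
    change Continuous fun X => R + Bᴴ * bar X * B
    fun_prop
  have hi : ContinuousAt (fun X => (RX B R X)⁻¹) X := by
    have : (fun X => (RX B R X)⁻¹) = fun X => (RX B R X).det⁻¹ • (RX B R X).adjugate := by
      funext X; rw [Matrix.inv_def, Ring.inverse_eq_inv']
    rw [this]
    exact (hw.matrix_det.continuousAt.inv₀ hd).smul hw.matrix_adjugate.continuousAt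
  unfold ric
  fun_prop

/-- Two conjugated steps remove the conjugation from the argument and the constants cancel; this is
why `𝕋` is defined through `conj(T) T`. -/
theorem policy_bar_policy_bar (F : Matrix (Fin m) (Fin n) ℂ) (X Z : Matrix (Fin n) (Fin n) ℂ) :
    policy A B R H F (bar (policy A B R H F (bar X))) -
      policy A B R H F (bar (policy A B R H F (bar Z))) =
      (bar (A - B * F) * (A - B * F))ᴴ * (X - Z) * (bar (A - B * F) * (A - B * F)) := by
  simp only [policy]
  generalize A - B * F = T
  simp only [bar_add, bar_mul, bar_bar, bar_conjTranspose, Matrix.conjTranspose_mul,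
    Matrix.mul_add, Matrix.add_mul, Matrix.mul_sub, Matrix.sub_mul, Matrix.mul_assoc]
  abel

theorem ric_le_self_of_mem_startSet (hR : R.IsHermitian) (hX : X ∈ startSet A B R H)
    (hp : (RX B R X).PosDef) : ric A B R H X ≤ X := by
  obtain ⟨hXh, W, -, hW⟩ := hX
  exact (dric_le_policy hR (bar_isHermitian hXh) hp _).trans (le_sub_iff_add_le'.1 hW)

/-- Elements of `𝓢_≥` dominate the solutions of `Z ≤ 𝓡(𝓡(Z))` with positive definite weights. -/
theorem le_of_mem_startSet (hR : R.IsHermitian) (hH : H.IsHermitian)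
    (hX : X ∈ startSet A B R H) (hZ : Z.IsHermitian) (hp : (RX B R Z).PosDef)
    (hp' : (RX B R (ric A B R H Z)).PosDef) (hle : Z ≤ ric A B R H (ric A B R H Z)) :
    Z ≤ X := by
  obtain ⟨-, W, hWs, hW⟩ := hX
  set F := FX A B R W
  have hLX : policy A B R H F (bar X) ≤ X := le_sub_iff_add_le'.1 hW
  have hLLX := (policy_mono (A := A) (B := B) (R := R) (H := H) (bar_mono hLX) F).trans hLX
  have hY : (ric A B R H Z).IsHermitian := ric_isHermitian hR hH ⟨hZ, hp.det_pos.ne'⟩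
  have hLZ : ric A B R H Z ≤ policy A B R H F (bar Z) :=
    dric_le_policy hR (bar_isHermitian hZ) hp F
  have hLLZ : Z ≤ policy A B R H F (bar (policy A B R H F (bar Z))) :=
    (hle.trans (dric_le_policy hR (bar_isHermitian hY) hp' F)).trans
      (policy_mono (bar_mono hLZ) F)
  refine sub_nonneg.1 (nonneg_of_stein_le hWs.2 ?_)
  have h := sub_le_sub hLLX hLLZ
  rwa [policy_bar_policy_bar] at h

theorem startSet_nonempty (hR : R.IsHermitian) (hH : H.IsHermitian)
    (hT : (stabSet A B R).Nonempty) : (startSet A B R H).Nonempty := by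
  obtain ⟨W, hW⟩ := hT
  have hc : (H + (FX A B R W)ᴴ * R * FX A B R W).IsHermitian :=
    hH.add (Matrix.isHermitian_conjTranspose_mul_mul _ hR)
  obtain ⟨V, hV, hVeq⟩ := exists_stein_solution hW.2 hc
  -- With `T = T_W`, adding one conjugated step to `V` makes `X - Tᴴ X̄ T` telescope to `V - (T̄ T)ᴴ
  -- V (T̄ T)`, so equality holds.
  refine ⟨V + (TX A B R W)ᴴ * bar V * TX A B R W,
    hV.add (Matrix.isHermitian_conjTranspose_mul_mul _ (bar_isHermitian hV)), W, hW, ?_⟩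
  rw [← hVeq]
  refine le_of_eq ?_
  simp only [bar_add, bar_mul, bar_bar, bar_conjTranspose, Matrix.conjTranspose_mul,
    Matrix.mul_add, Matrix.add_mul, Matrix.mul_assoc]
  abel

theorem le_iterate_ric (hR : R.IsHermitian) (hP : P.IsHermitian) (hPp : (RX B R P).PosDef)
    (hPs : P ≤ ric A B R H P) (h : P ≤ X) (k : ℕ) : P ≤ (ric A B R H)^[k] X := by
  induction k with
  | zero => exact h
  | succ k ih =>
    rw [Function.iterate_succ_apply']
    exact hPs.trans (ric_mono hR hP hPp ih)

theorem antitone_iterate_ric (hR : R.IsHermitian) (hP : P.IsHermitian)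
    (hPp : (RX B R P).PosDef) (hPs : P ≤ ric A B R H P) (h : P ≤ X)
    (hX : ric A B R H X ≤ X) : Antitone fun k : ℕ => (ric A B R H)^[k] X := by
  have hk := le_iterate_ric hR hP hPp hPs h
  refine antitone_nat_of_succ_le fun k => ?_
  induction k with
  | zero => exact hX
  | succ k ih =>
    rw [Function.iterate_succ_apply', Function.iterate_succ_apply' _ k]
    rw [Function.iterate_succ_apply'] at ih
    have h1 := hk (k + 1)
    rw [Function.iterate_succ_apply'] at h1
    exact ric_mono hR (isHermitian_of_le hP h1) (RX_posDef_mono hPp h1) ih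

/-- Only even iterates are compared, since `Z` need not be fixed by a single application of `𝓡`. -/
theorem le_iterate_ric_two_mul (hR : R.IsHermitian) (hH : H.IsHermitian) (hZ : Z.IsHermitian)
    (hp : (RX B R Z).PosDef) (hp' : (RX B R (ric A B R H Z)).PosDef)
    (heq : Z = ric A B R H (ric A B R H Z)) (h : Z ≤ X) (k : ℕ) :
    Z ≤ (ric A B R H)^[2 * k] X := by
  induction k with
  | zero => exact h
  | succ k ih =>
    rw [mul_add_one, Function.iterate_succ_apply', Function.iterate_succ_apply']
    have hY : (ric A B R H Z).IsHermitian := ric_isHermitian hR hH ⟨hZ, hp.det_pos.ne'⟩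
    exact heq.le.trans (ric_mono hR hY hp' (ric_mono hR hZ hp ih))

theorem exists_limit_of_mem_startSet (hR : R.IsHermitian) (hH : H.IsHermitian)
    (hP : P.IsHermitian) (hPp : (RX B R P).PosDef) (hPs : P ≤ ric A B R H P)
    (hPX : P ≤ X) (hX : X ∈ startSet A B R H) :
    ∃ L, Filter.Tendsto (fun k : ℕ => (ric A B R H)^[k] X) Filter.atTop (nhds L) ∧
      L ∈ solutions A B R H ∧ (RX B R L).PosDef ∧
      ∀ Z : Matrix (Fin n) (Fin n) ℂ, Z.IsHermitian → (RX B R Z).PosDef →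
        (RX B R (ric A B R H Z)).PosDef → Z = ric A B R H (ric A B R H Z) → Z ≤ L := by
  have := orderClosedTopology_matrix (ι := Fin n)
  have hk := le_iterate_ric hR hP hPp hPs hPX
  have hanti := antitone_iterate_ric hR hP hPp hPs hPX
    (ric_le_self_of_mem_startSet hR hX (RX_posDef_mono hPp hPX))
  obtain ⟨L, hL⟩ := exists_tendsto_of_antitone hanti hk
  have hPL : P ≤ L := ge_of_tendsto hL (.of_forall hk)
  have hpL : (RX B R L).PosDef := RX_posDef_mono hPp hPL
  refine ⟨L, hL, ⟨⟨isHermitian_of_le hP hPL, hpL.det_pos.ne'⟩, ?_⟩, hpL, ?_⟩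
  · have h1 := (continuousAt_ric (A := A) (H := H) hpL.det_pos.ne').tendsto.comp hL
    have h2 := (Filter.tendsto_add_atTop_iff_nat 1).2 hL
    simp only [Function.iterate_succ_apply'] at h2
    exact tendsto_nhds_unique h2 h1
  · intro Z hZ hp hp' heq
    have hZX := le_of_mem_startSet hR hH hX hZ hp hp' heq.le
    have h2 := hL.comp (Filter.tendsto_id.const_mul_atTop' (r := 2) two_pos)
    exact ge_of_tendsto h2 (.of_forall (le_iterate_ric_two_mul hR hH hZ hp hp' heq hZX))

theorem iterate_hatRic_eq (hR : R.IsHermitian) (hRdet : R.det ≠ 0) (hH : H.IsHermitian)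
    (hRH : (RX B R H).det ≠ 0) (hdom : ∀ k : ℕ, (ric A B R H)^[k] X ∈ dom B R) (k : ℕ) :
    (hatRic A B R H)^[k] X = (ric A B R H)^[2 * k] X := by
  induction k with
  | zero => rfl
  | succ k ih =>
    have h1 := hdom (2 * k + 1)
    rw [Function.iterate_succ_apply'] at h1
    rw [Function.iterate_succ_apply', ih, hatRic_eq_ric_ric hR hRdet hH hRH (hdom _) h1,
      mul_add_one, Function.iterate_succ_apply', Function.iterate_succ_apply']

theorem mem_hatDom (hX : X ∈ dom B R) (hY : ric A B R H X ∈ dom B R) :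
    X ∈ hatDom A B R H := by
  refine ⟨hX.1, ?_⟩
  rw [det_hatRX hX]
  exact mul_ne_zero (by simpa using hX.2) hY.2

theorem solutions_subset_compSolutions :
    solutions A B R H ⊆ compSolutions A B R H := by
  rintro X ⟨hX, heq⟩
  refine ⟨hX, ?_, ?_⟩ <;> rw [← heq]
  exacts [hX, heq]

theorem compSolutions_subset_hatSolutions (hR : R.IsHermitian) (hRdet : R.det ≠ 0)
    (hH : H.IsHermitian) (hRH : (RX B R H).det ≠ 0) :
    compSolutions A B R H ⊆ hatSolutions A B R H := by
  rintro X ⟨hX, hY, heq⟩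
  exact ⟨mem_hatDom hX hY, by rw [hatRic_eq_ric_ric hR hRdet hH hRH hX hY]; exact heq⟩

theorem hatR_isHermitian (hR : R.IsHermitian) (hH : H.IsHermitian) :
    (hatR B R H).IsHermitian :=
  (bar_isHermitian hR).fromBlocks (by simp) (wt_isHermitian hR (bar_isHermitian hH))

/-- Every solution of the transformed equation has positive definite weights and solves
`X = 𝓡(𝓡(X))`. -/
theorem posDef_of_mem_hatSolutions (hR : R.IsHermitian) (hRdet : R.det ≠ 0)
    (hH : H.IsHermitian) (hRH : (RX B R H).det ≠ 0) (hP : P.IsHermitian)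
    (hPp : (RX B R P).PosDef) (hPs : P ≤ ric A B R H P) (hZ : Z ∈ hatSolutions A B R H) :
    (RX B R Z).PosDef ∧ (RX B R (ric A B R H Z)).PosDef ∧
      Z = ric A B R H (ric A B R H Z) := by
  obtain ⟨⟨hZh, hZd⟩, hZeq⟩ := hZ
  have hPd : P ∈ dom B R := ⟨hP, hPp.det_pos.ne'⟩
  have hPp' := RX_posDef_mono hPp hPs
  have hPd' : ric A B R H P ∈ dom B R := ⟨isHermitian_of_le hP hPs, hPp'.det_pos.ne'⟩
  -- `P` is also a positively weighted subsolution of the transformed equation, so the unit-circle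
  -- argument applies to the hatted data.
  have hsub : P ≤ hatRic A B R H P := by
    rw [hatRic_eq_ric_ric hR hRdet hH hRH hPd hPd']
    exact hPs.trans (ric_mono hR hP hPp hPs)
  have hpos : (hatRX A B R H Z).PosDef :=
    wt_posDef_of_solution (hatR_isHermitian hR hH) hZh hP (hatRX_posDef hP hPp hPp') hsub
      hZd hZeq
  obtain ⟨h1, h2⟩ := RX_posDef_of_hatRX_posDef hZh hpos
  have hZdom : Z ∈ dom B R := ⟨hZh, h1.det_pos.ne'⟩
  refine ⟨h1, h2, ?_⟩
  rwa [hatRic_eq_ric_ric hR hRdet hH hRH hZdom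
    ⟨ric_isHermitian hR hH hZdom, h2.det_pos.ne'⟩] at hZeq

end Iteration
end CDARE

/-! ### The common maximal solution -/

theorem mainTheorem1 (n m : ℕ)
    (A : Matrix (Fin n) (Fin n) ℂ) (B : Matrix (Fin n) (Fin m) ℂ)
    (R : Matrix (Fin m) (Fin m) ℂ) (H : Matrix (Fin n) (Fin n) ℂ)
    (hR : R.IsHermitian) (hRdet : R.det ≠ 0) (hH : H.IsHermitian)
    (hT : (CDARE.stabSet A B R).Nonempty)
    (hP : (CDARE.subSolutions A B R H ∩ CDARE.posSet B R).Nonempty)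
    (hRH : (CDARE.RX B R H).det ≠ 0) :
    ∃ XM : Matrix (Fin n) (Fin n) ℂ,
      IsGreatest (CDARE.solutions A B R H) XM ∧
      IsGreatest (CDARE.hatSolutions A B R H) XM ∧
      IsGreatest (CDARE.compSolutions A B R H) XM ∧
      (CDARE.RX B R XM).PosDef ∧
      (CDARE.hatRX A B R H XM).PosDef ∧
      (CDARE.startSet A B R H).Nonempty ∧
      ∀ X₀ ∈ CDARE.startSet A B R H,
        (∀ k : ℕ, (CDARE.ric A B R H)^[k] X₀ ∈ CDARE.dom B R) ∧
        (∀ k : ℕ, (CDARE.hatRic A B R H)^[k] X₀ ∈ CDARE.hatDom A B R H) ∧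
        (∀ k : ℕ, (CDARE.hatRic A B R H)^[k] X₀ = (CDARE.ric A B R H)^[2 * k] X₀) ∧
        Antitone (fun k : ℕ => (CDARE.ric A B R H)^[k] X₀) ∧
        Filter.Tendsto (fun k : ℕ => (CDARE.ric A B R H)^[k] X₀) Filter.atTop (nhds XM) ∧
        Filter.Tendsto (fun k : ℕ => (CDARE.hatRic A B R H)^[k] X₀) Filter.atTop (nhds XM) := by
  open CDARE in
  obtain ⟨P, ⟨⟨hPh, -⟩, hPs⟩, -, hPp⟩ := hP
  have hstart := startSet_nonempty (H := H) hR hH hT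
  have hPX : ∀ X ∈ startSet A B R H, P ≤ X := fun X hX =>
    le_of_mem_startSet hR hH hX hPh hPp (RX_posDef_mono hPp hPs)
      (hPs.trans (ric_mono hR hPh hPp hPs))
  have hlim := fun X hX => exists_limit_of_mem_startSet hR hH hPh hPp hPs (hPX X hX) hX
  obtain ⟨X₁, hX₁⟩ := hstart
  obtain ⟨L, -, hLsol, hLp, hLmax⟩ := hlim X₁ hX₁
  have hLp' : (RX B R (ric A B R H L)).PosDef := by rwa [← hLsol.2]
  have hLcomp := solutions_subset_compSolutions hLsol
  have hsub := compSolutions_subset_hatSolutions (A := A) hR hRdet hH hRH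
  have hub : L ∈ upperBounds (hatSolutions A B R H) := fun Z hZ => by
    obtain ⟨h1, h2, h3⟩ := posDef_of_mem_hatSolutions hR hRdet hH hRH hPh hPp hPs hZ
    exact hLmax Z hZ.1.1 h1 h2 h3
  refine ⟨L, ⟨hLsol, fun Z hZ => hub (hsub (solutions_subset_compSolutions hZ))⟩,
    ⟨hsub hLcomp, hub⟩, ⟨hLcomp, fun Z hZ => hub (hsub hZ)⟩, hLp,
    hatRX_posDef hLsol.1.1 hLp hLp', ⟨X₁, hX₁⟩, fun X hX => ?_⟩
  have hk := le_iterate_ric hR hPh hPp hPs (hPX X hX)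
  have hdom : ∀ k : ℕ, (ric A B R H)^[k] X ∈ dom B R := fun k =>
    ⟨isHermitian_of_le hPh (hk k), (RX_posDef_mono hPp (hk k)).det_pos.ne'⟩
  have heq := iterate_hatRic_eq hR hRdet hH hRH hdom
  obtain ⟨L', hL', hsol', hp', hmax'⟩ := hlim X hX
  -- Limits from different starting points are solutions that bound each other, so the limit does
  -- not depend on the start.
  have hLL : L' = L := by
    refine le_antisymm (hub (hsub (solutions_subset_compSolutions hsol'))) ?_
    exact hmax' L hLsol.1.1 hLp hLp' hLcomp.2.2
  subst hLL
  refine ⟨hdom, fun k => ?_, heq, ?_, hL', ?_⟩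
  · rw [heq]
    refine mem_hatDom (hdom _) ?_
    rw [← Function.iterate_succ_apply' (ric A B R H)]
    exact hdom _
  · exact antitone_iterate_ric hR hPh hPp hPs (hPX X hX)
      (ric_le_self_of_mem_startSet hR hX (RX_posDef_mono hPp (hPX X hX)))
  · simp only [heq]
    exact hL'.comp (Filter.tendsto_id.const_mul_atTop' (r := 2) two_pos)
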